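/- Let $\Omega$ be a commutative semigroup (written additively), let $k$ be a field, and let $\mathcal H^\Omega$ be the $k$-vector space with basis the set $\Omega^*$ of words on $\Omega$, the empty word $\mathbf 1$ included. Let $*$ be the quasi-shuffle product on $\mathcal H^\Omega$, that is, the bilinear product with unit $\mathbf 1$ such that, for letters $a,b$ and words $\mathbf u,\mathbf v$, $$a\mathbf u * b\mathbf v = a(\mathbf u * b\mathbf v)+b(a\mathbf u*\mathbf v)+[a+b](\mathbf u*\mathbf v),$$ where $[a+b]\in\Omega$ is the sum in the semigroup. Let $\Delta(\omega_1\cdots\omega_p)=\sum_{j=0}^{p}\omega_1\cdots\omega_j\otimes\omega_{j+1}\cdots\omega_p$ be deconcatenation, with counit $\varepsilon$ ($\varepsilon(\mathbf 1)=1$, $\varepsilon=0$ on nonempty words); then $(\mathcal H^\Omega,*,\Delta)$ is a Hopf algebra (Hoffman's quasi-shuffle Hopf algebra). Let $S$ be its antipode and $u:k\to\mathcal H^\Omega$ its unit map. For a nonempty word write $\|\omega_1\cdots\omega_n\|=[\omega_1+\cdots+\omega_n]\in\Omega$, and define the linear map $\Gamma:\mathcal H^\Omega\to\mathcal H^\Omega\otimes\mathcal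 H^\Omega$ on words by $$\Gamma(\boldsymbol\omega)=\sum_{\boldsymbol\omega=\boldsymbol\omega^1\cdots\boldsymbol\omega^s}\|\boldsymbol\omega^1\|\cdots\|\boldsymbol\omega^s\|\otimes(\boldsymbol\omega^1*\cdots*\boldsymbol\omega^s),$$ the sum being over all splittings of $\boldsymbol\omega$ into consecutive nonempty words; in particular $\Gamma(\mathbf 1)=\mathbf 1\otimes\mathbf 1$. **Theorem 3.1.** (1) $\Gamma$ is coassociative and is a morphism of unital algebras for $*$, and it admits a counit $\eta:\mathcal H^\Omega\to k$ which is an algebra morphism; so $(\mathcal H^\Omega,*,\Gamma)$ is a bialgebra. (2) If $\Omega$ has at least two elements, then $\Gamma$ is not cocommutative. (3) $(\mathcal H^\Omega,*,\Delta)$ is a right comodule-Hopf algebra over the bialgebra $(\mathcal H^\Omega,*,\Gamma)$ with coaction $\Gamma$: the map $\Gamma$ is a coassociative and counital right coaction, and $$(\Delta\otimes\mathrm{Id})\,\Gamma=(\mathrm{Id}\otimes\mathrm{Id}\otimes *)\,\tau_{23}\,(\Gamma\otimes\Gamma)\,\Delta,\qquad(\varepsilon\otimes\mathrm{Id})\,\Gamma=u\,\varepsilon,\qquad(S\otimes\mathrm{Id})\,\Gamma=\Gamma\,S,$$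 where $\tau_{23}$ exchanges the second and third tensor factors, and all the maps in these identities are algebra morphisms for $*$. -/

import Mathlib

open scoped TensorProduct

noncomputable section

/-- The vector space `H^Ω` over `k` with basis the words on the alphabet `Ω`.
(A type synonym, since the finitely supported functions carry a pointwise product in Mathlib,
which is not the product that is wanted here.) -/
def QSh (k : Type*) [Field k] (Ω : Type*) : Type _ := List Ω →₀ k

namespace QSh

variable {k : Type*} [Field k] {Ω : Type*}

instance instAddCommGroup : AddCommGroup (QSh k Ω) :=
  inferInstanceAs (AddCommGroup (List Ω →₀ k))

instance instModule : Module k (QSh k Ω) :=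
  inferInstanceAs (Module k (List Ω →₀ k))

/-- The basis of `H^Ω` given by the words. -/
def wordBasis (k : Type*) [Field k] (Ω : Type*) : Module.Basis (List Ω) k (QSh k Ω) :=
  Module.Basis.ofRepr (LinearEquiv.refl k (List Ω →₀ k))

/-- A word, as an element of `H^Ω`. -/
def word (k : Type*) [Field k] {Ω : Type*} (u : List Ω) : QSh k Ω := wordBasis k Ω u

/-- The linear map prefixing the letter `a` to a word. -/
def consMap (k : Type*) [Field k] {Ω : Type*} (a : Ω) : QSh k Ω →ₗ[k] QSh k Ω :=
  (wordBasis k Ω).constr k fun u => word k (a :: u)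

@[simp] theorem consMap_word (a : Ω) (u : List Ω) :
    consMap k a (word k u) = word k (a :: u) := by
  simp only [consMap, word, Module.Basis.constr_basis]

theorem wordBasis_apply (u : List Ω) : wordBasis k Ω u = word k u := rfl

theorem hom_ext {M : Type*} [AddCommMonoid M] [Module k M] {f g : QSh k Ω →ₗ[k] M}
    (h : ∀ u, f (word k u) = g (word k u)) : f = g :=
  (wordBasis k Ω).ext h

/-! ### The quasi-shuffle product -/

section Product

variable [AddCommSemigroup Ω]

/-- The quasi-shuffle product of two words. -/
def qsh (k : Type*) [Field k] {Ω : Type*} [AddCommSemigroup Ω] : List Ω → List Ω → QSh k Ω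
  | [], v => word k v
  | a :: u, [] => word k (a :: u)
  | a :: u, b :: v =>
      consMap k a (qsh k u (b :: v)) + consMap k b (qsh k (a :: u) v)
        + consMap k (a + b) (qsh k u v)
termination_by u v => u.length + v.length

/-- The bilinear extension of the quasi-shuffle product. -/
def qshMul (k : Type*) [Field k] (Ω : Type*) [AddCommSemigroup Ω] :
    QSh k Ω →ₗ[k] QSh k Ω →ₗ[k] QSh k Ω :=
  (wordBasis k Ω).constr k fun u => (wordBasis k Ω).constr k fun v => qsh k u v

theorem qshMul_word (u v : List Ω) : qshMul k Ω (word k u) (word k v) = qsh k u v := by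
  simp only [qshMul, word, Module.Basis.constr_basis]

theorem qsh_nil_left (v : List Ω) : qsh k [] v = word k v := by simp [qsh]

theorem qsh_nil_right (u : List Ω) : qsh k u [] = word k u := by cases u <;> simp [qsh]

theorem qsh_comm (u v : List Ω) : qsh k u v = qsh k v u := by
  induction u generalizing v with
  | nil => rw [qsh_nil_left, qsh_nil_right]
  | cons a u ihu =>
    induction v with
    | nil => rw [qsh_nil_left, qsh_nil_right]
    | cons b v ihv =>
      rw [qsh, qsh, ihu (b :: v), ihu v, ihv, add_comm b a]
      abel

theorem qshMul_comm (x y : QSh k Ω) : qshMul k Ω x y = qshMul k Ω y x := by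
  have : qshMul k Ω = (qshMul k Ω).flip := hom_ext fun u => hom_ext fun v => by
    rw [LinearMap.flip_apply, qshMul_word, qshMul_word, qsh_comm]
  exact LinearMap.congr_fun₂ this x y

theorem qshMul_one_left (x : QSh k Ω) : qshMul k Ω (word k []) x = x := by
  have : qshMul k Ω (word k []) = LinearMap.id := hom_ext fun u => by
    rw [qshMul_word, qsh_nil_left, LinearMap.id_apply]
  exact LinearMap.congr_fun this x

theorem qshMul_consMap (a b : Ω) (x y : QSh k Ω) :
    qshMul k Ω (consMap k a x) (consMap k b y) =
      consMap k a (qshMul k Ω x (consMap k b y))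
      + consMap k b (qshMul k Ω (consMap k a x) y)
      + consMap k (a + b) (qshMul k Ω x y) := by
  have : (qshMul k Ω).compl₁₂ (consMap k a) (consMap k b) =
      ((qshMul k Ω).compl₂ (consMap k b)).compr₂ (consMap k a)
      + ((qshMul k Ω).comp (consMap k a)).compr₂ (consMap k b)
      + (qshMul k Ω).compr₂ (consMap k (a + b)) := hom_ext fun u => hom_ext fun v => by
    simp [qshMul_word, qsh]
  simpa using LinearMap.congr_fun₂ this x y

theorem qshMul_assoc_word (u v w : List Ω) :
    qshMul k Ω (qshMul k Ω (word k u) (word k v)) (word k w) =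
      qshMul k Ω (word k u) (qshMul k Ω (word k v) (word k w)) := by
  induction u generalizing v w with
  | nil => simp only [qshMul_one_left]
  | cons a u ihu =>
    induction v generalizing w with
    | nil => rw [qshMul_one_left, qshMul_comm (word k (a :: u)), qshMul_one_left]
    | cons b v ihv =>
      induction w with
      | nil =>
        rw [qshMul_comm _ (word k []), qshMul_one_left, qshMul_comm _ (word k []),
          qshMul_one_left]
      | cons c w ihw =>
        have h1 := ihu (b :: v) (c :: w)
        have h2 := ihv (c :: w)
        have h3 := ihu v (c :: w)
        have h4 := ihu (b :: v) w
        have h5 := ihv w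
        have h6 := ihu v w
        simp only [← consMap_word] at h1 h2 h3 h4 h5 h6 ihw ⊢
        simp only [qshMul_consMap, map_add, LinearMap.add_apply, add_assoc] at h1 h2 h3 h4 h5 h6 ihw ⊢
        rw [h1, h2, h3, h4, h5, h6, ← ihw]
        simp only [map_add]
        abel

theorem qshMul_assoc (x y z : QSh k Ω) :
    qshMul k Ω (qshMul k Ω x y) z = qshMul k Ω x (qshMul k Ω y z) := by
  have h1 (u v : List Ω) : qshMul k Ω (qshMul k Ω (word k u) (word k v)) =
      qshMul k Ω (word k u) ∘ₗ qshMul k Ω (word k v) :=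
    hom_ext fun w => qshMul_assoc_word u v w
  have h2 (u : List Ω) : (qshMul k Ω).flip z ∘ₗ qshMul k Ω (word k u) =
      qshMul k Ω (word k u) ∘ₗ (qshMul k Ω).flip z :=
    hom_ext fun v => LinearMap.congr_fun (h1 u v) z
  have h3 : (qshMul k Ω).flip z ∘ₗ (qshMul k Ω).flip y =
      (qshMul k Ω).flip (qshMul k Ω y z) :=
    hom_ext fun u => LinearMap.congr_fun (h2 u) y
  exact LinearMap.congr_fun h3 x

/-- `H^Ω` is a commutative ring for the quasi-shuffle product; its unit is the empty word. -/
instance instCommRing : CommRing (QSh k Ω) where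
  mul x y := qshMul k Ω x y
  one := word k []
  mul_assoc := qshMul_assoc
  mul_comm := qshMul_comm
  one_mul := qshMul_one_left
  mul_one x := (qshMul_comm x _).trans (qshMul_one_left x)
  left_distrib x y z := map_add (qshMul k Ω x) y z
  right_distrib x y z := LinearMap.map_add₂ (qshMul k Ω) x y z
  zero_mul x := LinearMap.map_zero₂ (qshMul k Ω) x
  mul_zero x := map_zero (qshMul k Ω x)
  zsmul := (instAddCommGroup (k := k) (Ω := Ω)).zsmul
  zsmul_zero' := (instAddCommGroup (k := k) (Ω := Ω)).zsmul_zero'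
  zsmul_succ' := (instAddCommGroup (k := k) (Ω := Ω)).zsmul_succ'
  zsmul_neg' := (instAddCommGroup (k := k) (Ω := Ω)).zsmul_neg'
  neg_add_cancel := (instAddCommGroup (k := k) (Ω := Ω)).neg_add_cancel
  nsmul := (instAddCommGroup (k := k) (Ω := Ω)).nsmul
  nsmul_zero := (instAddCommGroup (k := k) (Ω := Ω)).nsmul_zero
  nsmul_succ := (instAddCommGroup (k := k) (Ω := Ω)).nsmul_succ
  sub_eq_add_neg := (instAddCommGroup (k := k) (Ω := Ω)).sub_eq_add_neg

/-- The `k`-algebra `(H^Ω, quasi-shuffle)`. -/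
instance instAlgebra : Algebra k (QSh k Ω) :=
  Algebra.ofModule (fun r x y => LinearMap.map_smul₂ (qshMul k Ω) r x y)
    (fun r x y => map_smul (qshMul k Ω x) r y)

theorem one_def : (1 : QSh k Ω) = word k [] := rfl

theorem mul_def (x y : QSh k Ω) : x * y = qshMul k Ω x y := rfl

theorem word_mul_word (u v : List Ω) : word k u * word k v = qsh k u v := qshMul_word u v

theorem consMap_mul_consMap (a b : Ω) (x y : QSh k Ω) :
    consMap k a x * consMap k b y =
      consMap k a (x * consMap k b y) + consMap k b (consMap k a x * y)
        + consMap k (a + b) (x * y) :=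
  qshMul_consMap a b x y

end Product

/-! ### The deconcatenation coproduct, its counit and the antipode -/

/-- The deconcatenation coproduct, `Δ(ω₁⋯ωₚ) = ∑_{j=0}^{p} ω₁⋯ωⱼ ⊗ ωⱼ₊₁⋯ωₚ`. -/
def deconc (k : Type*) [Field k] (Ω : Type*) : QSh k Ω →ₗ[k] QSh k Ω ⊗[k] QSh k Ω :=
  (wordBasis k Ω).constr k fun u =>
    ∑ j ∈ Finset.range (u.length + 1), word k (u.take j) ⊗ₜ[k] word k (u.drop j)

/-- The counit of the deconcatenation coproduct: `1` on the empty word and `0` on all others. -/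
def deconcCounit (k : Type*) [Field k] (Ω : Type*) : QSh k Ω →ₗ[k] k :=
  (wordBasis k Ω).constr k fun u => if u = [] then 1 else 0

theorem deconc_word (u : List Ω) : deconc k Ω (word k u) =
    ∑ j ∈ Finset.range (u.length + 1), word k (u.take j) ⊗ₜ[k] word k (u.drop j) := by
  simp only [deconc, word, Module.Basis.constr_basis]

theorem deconcCounit_word (u : List Ω) :
    deconcCounit k Ω (word k u) = if u = [] then 1 else 0 := by
  simp only [deconcCounit, word, Module.Basis.constr_basis]

theorem deconc_word_nil : deconc k Ω (word k []) = word k [] ⊗ₜ[k] word k [] := by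
  simp [deconc_word]

theorem deconc_consMap (a : Ω) (x : QSh k Ω) : deconc k Ω (consMap k a x) =
    word k [] ⊗ₜ[k] consMap k a x + (consMap k a).rTensor (QSh k Ω) (deconc k Ω x) := by
  have : deconc k Ω ∘ₗ consMap k a = TensorProduct.mk k _ _ (word k []) ∘ₗ consMap k a
      + (consMap k a).rTensor (QSh k Ω) ∘ₗ deconc k Ω := hom_ext fun u => by
    rw [LinearMap.comp_apply, consMap_word, deconc_word, List.length_cons,
      Finset.sum_range_succ', add_comm]
    simp [deconc_word]
  exact LinearMap.congr_fun this x

theorem deconcCounit_consMap (a : Ω) (x : QSh k Ω) : deconcCounit k Ω (consMap k a x) = 0 := by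
  have : deconcCounit k Ω ∘ₗ consMap k a = 0 := hom_ext fun u => by
    simp [deconcCounit_word]
  exact LinearMap.congr_fun this x

/-- The coalgebra `(H^Ω, Δ)`. -/
instance instCoalgebra : Coalgebra k (QSh k Ω) where
  comul := deconc k Ω
  counit := deconcCounit k Ω
  coassoc := hom_ext fun u => by
    induction u with
    | nil => simp [deconc_word_nil]
    | cons a u ih =>
      simp only [← consMap_word, LinearMap.comp_apply, LinearEquiv.coe_coe] at ih ⊢
      have e1 (t : QSh k Ω ⊗[k] QSh k Ω) :
          (TensorProduct.assoc k _ _ _) ((deconc k Ω).rTensor _ ((consMap k a).rTensor _ t)) =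
          word k [] ⊗ₜ (consMap k a).rTensor _ t + (consMap k a).rTensor _
            ((TensorProduct.assoc k _ _ _) ((deconc k Ω).rTensor _ t)) := by
        induction t with
        | zero => simp
        | add x y hx hy => simp only [map_add, hx, hy, TensorProduct.tmul_add]; abel
        | tmul x y =>
          simp only [LinearMap.rTensor_tmul, deconc_consMap, TensorProduct.add_tmul, map_add,
            TensorProduct.assoc_tmul]
          congr 1
          induction deconc k Ω x with
          | zero => simp
          | add x y hx hy => simp only [map_add, hx, hy, TensorProduct.add_tmul]
          | tmul x z => simp
      have e2 (t : QSh k Ω ⊗[k] QSh k Ω) :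
          (deconc k Ω).lTensor _ ((consMap k a).rTensor _ t) =
          (consMap k a).rTensor _ ((deconc k Ω).lTensor _ t) := by
        induction t with
        | zero => simp
        | add x y hx hy => simp only [map_add, hx, hy]
        | tmul x y => simp
      simp only [deconc_consMap, map_add, e1, e2, ih, LinearMap.rTensor_tmul, deconc_word_nil,
        TensorProduct.assoc_tmul, LinearMap.lTensor_tmul, TensorProduct.tmul_add]
      abel
  rTensor_counit_comp_comul := hom_ext fun u => by
    cases u with
    | nil => simp [deconc_word_nil, deconcCounit_word]
    | cons a u =>
      have : (deconcCounit k Ω).rTensor (QSh k Ω) ∘ₗ (consMap k a).rTensor (QSh k Ω) = 0 := by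
        rw [← LinearMap.rTensor_comp, show deconcCounit k Ω ∘ₗ consMap k a = 0 from
          LinearMap.ext (deconcCounit_consMap a), LinearMap.rTensor_zero]
      rw [← consMap_word, LinearMap.comp_apply, deconc_consMap, map_add,
        show (deconcCounit k Ω).rTensor (QSh k Ω) ((consMap k a).rTensor (QSh k Ω) _) = 0 from
          LinearMap.congr_fun this _]
      simp [deconcCounit_word]
  lTensor_counit_comp_comul := hom_ext fun u => by
    induction u with
    | nil => simp [deconc_word_nil, deconcCounit_word]
    | cons a u ih =>
      have : (deconcCounit k Ω).lTensor (QSh k Ω) ∘ₗ (consMap k a).rTensor (QSh k Ω) =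
          (consMap k a).rTensor k ∘ₗ (deconcCounit k Ω).lTensor (QSh k Ω) := by
        rw [LinearMap.lTensor_comp_rTensor, LinearMap.rTensor_comp_lTensor]
      simp only [LinearMap.comp_apply] at ih
      rw [← consMap_word, LinearMap.comp_apply, deconc_consMap, map_add,
        show (deconcCounit k Ω).lTensor (QSh k Ω) ((consMap k a).rTensor (QSh k Ω) _) = _ from
          LinearMap.congr_fun this _, LinearMap.comp_apply, ih]
      simp [deconcCounit_consMap, - consMap_word]

theorem comul_def : (Coalgebra.comul : QSh k Ω →ₗ[k] _) = deconc k Ω := rfl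

theorem counit_def : (Coalgebra.counit : QSh k Ω →ₗ[k] k) = deconcCounit k Ω := rfl

section Hopf

variable [AddCommSemigroup Ω]

theorem deconcCounit_mul (x y : QSh k Ω) :
    deconcCounit k Ω (x * y) = deconcCounit k Ω x * deconcCounit k Ω y := by
  have : (LinearMap.mul k (QSh k Ω)).compr₂ (deconcCounit k Ω) =
      (LinearMap.mul k k).compl₁₂ (deconcCounit k Ω) (deconcCounit k Ω) :=
    hom_ext fun u => hom_ext fun v => by
      rcases u with _ | ⟨a, u⟩
      · simp [deconcCounit_word, qsh_nil_left, word_mul_word]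
      rcases v with _ | ⟨b, v⟩
      · simp [deconcCounit_word, qsh_nil_right, word_mul_word]
      simp only [← consMap_word, LinearMap.compr₂_apply, LinearMap.mul_apply',
        consMap_mul_consMap, map_add, deconcCounit_consMap, LinearMap.compl₁₂_apply]
      simp
  exact LinearMap.congr_fun₂ this x y

theorem rTensor_consMap_mul (a b : Ω) (s t : QSh k Ω ⊗[k] QSh k Ω) :
    (consMap k a).rTensor _ s * (consMap k b).rTensor _ t =
      (consMap k a).rTensor _ (s * (consMap k b).rTensor _ t)
      + (consMap k b).rTensor _ ((consMap k a).rTensor _ s * t)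
      + (consMap k (a + b)).rTensor _ (s * t) := by
  induction s with
  | zero => simp
  | add x y hx hy => simp only [map_add, add_mul, hx, hy]; abel
  | tmul x x' =>
    induction t with
    | zero => simp
    | add x y hx hy => simp only [map_add, mul_add, hx, hy]; abel
    | tmul y y' => simp [consMap_mul_consMap, TensorProduct.add_tmul]

theorem rTensor_consMap_mul_one_tmul (a : Ω) (s : QSh k Ω ⊗[k] QSh k Ω) (y : QSh k Ω) :
    (consMap k a).rTensor _ s * ((1 : QSh k Ω) ⊗ₜ y) =
      (consMap k a).rTensor _ (s * ((1 : QSh k Ω) ⊗ₜ y)) := by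
  induction s with
  | zero => simp
  | add x y hx hy => simp only [map_add, add_mul, hx, hy]
  | tmul x x' => simp

theorem deconc_mul_word (u v : List Ω) :
    deconc k Ω (word k u * word k v) = deconc k Ω (word k u) * deconc k Ω (word k v) := by
  induction u generalizing v with
  | nil => rw [deconc_word_nil, ← one_def, one_mul, ← Algebra.TensorProduct.one_def, one_mul]
  | cons a u ihu =>
    induction v with
    | nil => rw [deconc_word_nil, ← one_def, mul_one, ← Algebra.TensorProduct.one_def, mul_one]
    | cons b v ihv =>
      have h1 := ihu (b :: v)
      have h2 := ihu v
      simp only [← consMap_word] at h1 h2 ihv ⊢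
      rw [consMap_mul_consMap]
      simp only [map_add, deconc_consMap, ← one_def, h1, h2, ihv, add_mul, mul_add,
        rTensor_consMap_mul, rTensor_consMap_mul_one_tmul,
        mul_comm ((1 : QSh k Ω) ⊗ₜ[k] consMap k a (word k u)), Algebra.TensorProduct.tmul_mul_tmul,
        TensorProduct.tmul_add, one_mul, consMap_mul_consMap]
      rw [mul_comm (word k v) (consMap k a (word k u)), mul_comm (consMap k b (word k v)) (word k u),
        mul_comm (word k v) (word k u), add_comm b a]
      abel

theorem deconc_mul (x y : QSh k Ω) :
    deconc k Ω (x * y) = deconc k Ω x * deconc k Ω y := by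
  have : (LinearMap.mul k (QSh k Ω)).compr₂ (deconc k Ω) =
      (LinearMap.mul k (QSh k Ω ⊗[k] QSh k Ω)).compl₁₂ (deconc k Ω) (deconc k Ω) :=
    hom_ext fun u => hom_ext fun v => deconc_mul_word u v
  exact LinearMap.congr_fun₂ this x y

/-- The bialgebra `(H^Ω, quasi-shuffle, Δ)`. -/
instance instBialgebra : Bialgebra k (QSh k Ω) :=
  Bialgebra.mk' k (QSh k Ω) (by simp [counit_def, one_def, deconcCounit_word])
    (fun {x y} => deconcCounit_mul x y) deconc_word_nil (fun {x y} => deconc_mul x y)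

/-- The left convolution inverse of the identity, on words:
`S(1) = 1` and `S(ω) = - ∑ S(ω') ω''`, summed over the `ω = ω'.ω''` with `ω''` nonempty. -/
def antipodeWord (k : Type*) [Field k] {Ω : Type*} [AddCommSemigroup Ω] (u : List Ω) : QSh k Ω :=
  if u = [] then 1 else
    - ∑ j : Fin u.length, antipodeWord k (u.take j) * word k (u.drop j)
termination_by u.length
decreasing_by simp

/-- The antipode of `(H^Ω, quasi-shuffle, Δ)`. -/
def antipodeMap (k : Type*) [Field k] (Ω : Type*) [AddCommSemigroup Ω] : QSh k Ω →ₗ[k] QSh k Ω :=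
  (wordBasis k Ω).constr k (antipodeWord k)

/-- The right convolution inverse of the identity, on words. -/
def antipodeWordRight (k : Type*) [Field k] {Ω : Type*} [AddCommSemigroup Ω] (u : List Ω) :
    QSh k Ω :=
  if u = [] then 1 else
    - ∑ j : Fin u.length, word k (u.take (j + 1)) * antipodeWordRight k (u.drop (j + 1))
termination_by u.length
decreasing_by
  have := j.isLt
  simp only [List.length_drop]
  omega

theorem antipodeMap_word (u : List Ω) : antipodeMap k Ω (word k u) = antipodeWord k u := by
  simp only [antipodeMap, word, Module.Basis.constr_basis]

open WithConv in
theorem antipodeMap_convMul_id :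
    toConv (antipodeMap k Ω) * toConv (LinearMap.id : QSh k Ω →ₗ[k] QSh k Ω) = 1 := by
  refine WithConv.ext (hom_ext fun u => ?_)
  change LinearMap.mul' k _ (TensorProduct.map (antipodeMap k Ω) LinearMap.id
    (deconc k Ω (word k u))) = algebraMap k _ (deconcCounit k Ω (word k u))
  rw [deconc_word, map_sum, map_sum, Finset.sum_range_succ, deconcCounit_word]
  simp only [TensorProduct.map_tmul, antipodeMap_word, LinearMap.id_apply,
    LinearMap.mul'_apply, List.take_length, List.drop_length, ← one_def, mul_one]
  rw [antipodeWord.eq_def k u]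
  split_ifs with h
  · simp [h]
  · rw [Finset.sum_range]; simp

open WithConv in
theorem id_convMul_right :
    toConv (LinearMap.id : QSh k Ω →ₗ[k] QSh k Ω) *
      toConv ((wordBasis k Ω).constr k (antipodeWordRight k)) = 1 := by
  refine WithConv.ext (hom_ext fun u => ?_)
  change LinearMap.mul' k _ (TensorProduct.map LinearMap.id
    ((wordBasis k Ω).constr k (antipodeWordRight k))
    (deconc k Ω (word k u))) = algebraMap k _ (deconcCounit k Ω (word k u))
  rw [deconc_word, map_sum, map_sum, Finset.sum_range_succ', deconcCounit_word]
  simp only [TensorProduct.map_tmul, word, Module.Basis.constr_basis, LinearMap.id_apply,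
    LinearMap.mul'_apply, List.take_zero, List.drop_zero]
  simp only [wordBasis_apply, ← one_def, one_mul]
  rw [antipodeWordRight.eq_def k u]
  split_ifs with h
  · simp [h]
  · rw [Finset.sum_range]; simp

open WithConv in
theorem id_convMul_antipodeMap :
    toConv (LinearMap.id : QSh k Ω →ₗ[k] QSh k Ω) * toConv (antipodeMap k Ω) = 1 := by
  rw [left_inv_eq_right_inv (antipodeMap_convMul_id (k := k) (Ω := Ω)) id_convMul_right]
  exact id_convMul_right

/-- Hoffman's quasi-shuffle Hopf algebra `(H^Ω, quasi-shuffle, Δ)`. -/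
instance instHopfAlgebra : HopfAlgebra k (QSh k Ω) :=
  HopfAlgebra.ofConvInverse (antipodeMap k Ω) antipodeMap_convMul_id id_convMul_antipodeMap

end Hopf

/-! ### The decomposition coproduct -/

/-- The list of all splittings `ω = ω¹.⋯.ωˢ` of a word into nonempty words. -/
def splittings {Ω : Type*} : List Ω → List (List (List Ω))
  | [] => [[]]
  | a :: u => (splittings u).flatMap fun s =>
      match s with
      | [] => [[[a]]]
      | w :: t => [[a] :: w :: t, (a :: w) :: t]

theorem mem_splittings (u : List Ω) (s : List (List Ω)) :
    s ∈ splittings u ↔ s.flatten = u ∧ [] ∉ s := by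
  induction u generalizing s with
  | nil =>
    rcases s with _ | ⟨w, s⟩
    · simp [splittings]
    · rcases w with _ | ⟨b, w⟩ <;> simp [splittings]
  | cons a u ih =>
    simp only [splittings, List.mem_flatMap, ih]
    constructor
    · rintro ⟨t, ⟨rfl, ht⟩, hs⟩
      rcases t with _ | ⟨w, t⟩
      · simp_all
      · simp only [List.mem_cons, List.not_mem_nil, or_false, not_or] at hs ht
        rcases hs with rfl | rfl <;> simp_all
    · rintro ⟨h, hs⟩
      rcases s with _ | ⟨w, s⟩
      · simp at h
      rcases w with _ | ⟨b, w⟩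
      · simp at hs
      simp only [List.flatten_cons, List.cons_append, List.cons.injEq] at h
      obtain ⟨rfl, rfl⟩ := h
      simp only [List.mem_cons, reduceCtorEq, false_or] at hs
      rcases w with _ | ⟨c, w⟩
      · refine ⟨s, ⟨by simp, hs⟩, ?_⟩
        rcases s with _ | ⟨w, s⟩ <;> simp
      · exact ⟨(c :: w) :: s, ⟨by simp, by simpa using hs⟩, by simp⟩

theorem nodup_splittings (u : List Ω) : (splittings u).Nodup := by
  induction u with
  | nil => simp [splittings]
  | cons a u ih =>
    rw [splittings, List.nodup_flatMap]
    refine ⟨fun s hs => ?_, ?_⟩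
    · rcases s with _ | ⟨w, t⟩ <;> simp
    · refine ih.imp_of_mem fun {s t} hs ht hst => ?_
      have h1 := ((mem_splittings u s).1 hs).2
      have h2 := ((mem_splittings u t).1 ht).2
      rcases s with _ | ⟨w, s⟩ <;> rcases t with _ | ⟨w', t⟩ <;>
        simp_all [Function.onFun, List.disjoint_left]

section Gamma

variable [AddCommSemigroup Ω]

/-- The weight `[ω₁ + ⋯ + ωₙ] ∈ Ω` of the nonempty word `a ω₂⋯ωₙ`. -/
def weight {Ω : Type*} [AddCommSemigroup Ω] (a : Ω) : List Ω → Ω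
  | [] => a
  | b :: u => a + weight b u

/-- The word `‖ω¹‖⋯‖ωˢ‖` of the weights of the blocks of a splitting
(empty blocks, which do not occur in a splitting, have weight zero and contribute no letter). -/
def weights {Ω : Type*} [AddCommSemigroup Ω] : List (List Ω) → List Ω
  | [] => []
  | [] :: s => weights s
  | (a :: u) :: s => weight a u :: weights s

/-- The internal (decomposition) coproduct
`Γ(ω) = ∑ ‖ω¹‖⋯‖ωˢ‖ ⊗ (ω¹ * ⋯ * ωˢ)`, summed over the splittings `ω = ω¹.⋯.ωˢ` into nonempty
words, where `*` is the quasi-shuffle product. (The empty word has the single splitting with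
`s = 0`, which gives `Γ(1) = 1 ⊗ 1`.) -/
def gamma (k : Type*) [Field k] (Ω : Type*) [AddCommSemigroup Ω] :
    QSh k Ω →ₗ[k] QSh k Ω ⊗[k] QSh k Ω :=
  (wordBasis k Ω).constr k fun u =>
    ((splittings u).map fun s => word k (weights s) ⊗ₜ[k] (s.map (word k)).prod).sum

end Gamma

end QSh

end

/-!
Everything follows from a recursion over the first block of a splitting. For a nonempty word `w` let
`L(w)` be the operator on `H^Ω ⊗ H^Ω` that prefixes the letter `‖w‖` to the first factor and
multiplies the second by `w`, and let `L(1) = 0`. In Sweedler notation for deconcatenation,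
`Γ(x) = ε(x) 1 + ∑ L(x₁) Γ(x₂)` (`gamma_recursion`). On the right `Γ` is only evaluated at shorter
words, so an equation of this shape determines the map (`eq_of_recursion`).

* Both sides of `(Δ ⊗ Id) Γ = (Id ⊗ Id ⊗ *) τ₂₃ (Γ ⊗ Γ) Δ` solve one such recursion; for the right
  side this is coassociativity of `Δ` (`rTensor_deconc_gamma`).
* All words occurring in a quasi-shuffle `w * z` have weight `‖w‖ + ‖z‖`, so the operators `L(w)`
  satisfy the quasi-shuffle rule (`block_mul_block`), and `Γ` is multiplicative by induction on the
  total length (`gamma_mul`).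
* Both sides of coassociativity solve the recursion with `L(w)` replaced by
  `‖w‖ · ⊗ Γ(w) * ·`; one side uses multiplicativity of `Γ`, the other the coaction identity above
  and the fact that merging the blocks of `w` does not change its weight
  (`assoc_rTensor_gamma_gamma`).
* The counit of `Γ` is `1` on words of length at most one and `0` on longer words.
* `Γ S` and `(S ⊗ Id) Γ` are a left and a right convolution inverse of `Γ`: the first because `Γ` is
  multiplicative, the second because of the coaction identity (`map_antipode_comp_gamma`).
* For letters `a ≠ b`, `Γ(ab)` contains `ab ⊗ ba` but not `ba ⊗ ab` (`comm_comp_gamma_ne`).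
-/

noncomputable section

namespace QSh

variable {k : Type*} [Field k] {Ω : Type*}

/-! ### The recursion over the first block -/

section Recursion

/-- Deconcatenation with the cut before the first letter split off. -/
theorem deconc_word_eq_add (u : List Ω) : deconc k Ω (word k u) = word k [] ⊗ₜ[k] word k u +
    ∑ i ∈ Finset.range u.length, word k (u.take (i + 1)) ⊗ₜ[k] word k (u.drop (i + 1)) := by
  rw [deconc_word, Finset.sum_range_succ', add_comm]
  simp

variable {W : Type*} [AddCommGroup W] [Module k W]

theorem lift_deconc_word (β : QSh k Ω →ₗ[k] W →ₗ[k] W) (hβ : β (word k []) = 0)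
    (F : QSh k Ω →ₗ[k] W) (u : List Ω) :
    TensorProduct.lift (β.compl₂ F) (deconc k Ω (word k u)) =
      ∑ i ∈ Finset.range u.length, β (word k (u.take (i + 1))) (F (word k (u.drop (i + 1)))) := by
  simp [deconc_word_eq_add, hβ]

/-- If `β` kills the empty word, the equation `F(x) = N(x) + ∑ β(x₁) F(x₂)` has at most one
solution `F`: the terms on the right involve `F` only at strictly shorter words. -/
theorem eq_of_recursion (β : QSh k Ω →ₗ[k] W →ₗ[k] W) (hβ : β (word k []) = 0)
    (N F G : QSh k Ω →ₗ[k] W)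
    (hF : ∀ x, F x = N x + TensorProduct.lift (β.compl₂ F) (deconc k Ω x))
    (hG : ∀ x, G x = N x + TensorProduct.lift (β.compl₂ G) (deconc k Ω x)) : F = G := by
  refine hom_ext fun u => ?_
  induction h : u.length using Nat.strong_induction_on generalizing u with
  | _ n ih =>
    rw [hF, hG, lift_deconc_word β hβ, lift_deconc_word β hβ]
    congr 1
    refine Finset.sum_congr rfl fun i hi => ?_
    rw [ih _ _ _ rfl]
    simp only [List.length_drop]
    have := Finset.mem_range.1 hi
    omega

/-- A splitting of a nonempty word is a nonempty prefix followed by a splitting of the rest. -/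
theorem splittings_perm {u : List Ω} (hu : u ≠ []) : (splittings u).Perm
    ((List.range u.length).flatMap fun i =>
      (splittings (u.drop (i + 1))).map (u.take (i + 1) :: ·)) := by
  refine (List.perm_ext_iff_of_nodup (nodup_splittings u) ?_).2 fun s => ?_
  · rw [List.nodup_flatMap]
    refine ⟨fun i _ => (nodup_splittings _).map fun s t h => (List.cons.inj h).2, ?_⟩
    refine List.nodup_range.imp_of_mem fun {i j} hi hj hij => ?_
    simp only [List.mem_range] at hi hj
    simp only [Function.onFun, List.disjoint_left, List.mem_map, not_exists, not_and]
    rintro _ ⟨s, -, rfl⟩ t - h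
    have := congrArg List.length (List.cons.inj h).1
    simp only [List.length_take] at this
    omega
  · simp only [List.mem_flatMap, List.mem_map, mem_splittings, List.mem_range]
    constructor
    · rintro ⟨rfl, hs⟩
      rcases s with _ | ⟨w, s⟩
      · simp at hu
      rcases w with _ | ⟨a, w⟩
      · simp at hs
      · exact ⟨w.length, by simp, s, ⟨by simp, by simpa using hs⟩, by simp⟩
    · rintro ⟨i, hi, t, ⟨h1, h2⟩, rfl⟩
      refine ⟨by simp [h1], ?_⟩
      rcases u with _ | ⟨a, u⟩ <;> simp_all

variable [AddCommSemigroup Ω] {V : Type*} [AddCommGroup V] [Module k V]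
  {A : Type*} [Ring A] [Algebra k A]

/-- The bilinear extension of `(w, v ⊗ y) ↦ c_{‖w‖}(v) ⊗ φ(w) y` for nonempty words `w`, where `c`
is a family of operators indexed by `Ω`; the empty word, which has no weight, acts by zero. -/
def block (c : Ω → V →ₗ[k] V) (φ : QSh k Ω →ₗ[k] A) :
    QSh k Ω →ₗ[k] V ⊗[k] A →ₗ[k] V ⊗[k] A :=
  (wordBasis k Ω).constr k fun
    | [] => 0
    | a :: w => TensorProduct.map (c (weight a w)) (LinearMap.mulLeft k (φ (word k (a :: w))))

theorem block_nil (c : Ω → V →ₗ[k] V) (φ : QSh k Ω →ₗ[k] A) : block c φ (word k []) = 0 := by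
  simp only [block, word, Module.Basis.constr_basis]

theorem block_cons (c : Ω → V →ₗ[k] V) (φ : QSh k Ω →ₗ[k] A) (a : Ω) (w : List Ω) :
    block c φ (word k (a :: w)) =
      TensorProduct.map (c (weight a w)) (LinearMap.mulLeft k (φ (word k (a :: w)))) := by
  simp only [block, word, Module.Basis.constr_basis]

theorem gamma_word (u : List Ω) : gamma k Ω (word k u) =
    ((splittings u).map fun s => word k (weights s) ⊗ₜ[k] (s.map (word k)).prod).sum := by
  simp only [gamma, word, Module.Basis.constr_basis]

theorem gamma_nil : gamma k Ω (word k []) = 1 := by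
  rw [gamma_word]
  simp [splittings, weights, ← one_def, Algebra.TensorProduct.one_def]

/-- `Γ(u)` as a sum over the first block of the splitting. -/
theorem gamma_word_eq_sum {u : List Ω} (hu : u ≠ []) : gamma k Ω (word k u) =
    ∑ i ∈ Finset.range u.length, block (consMap k) LinearMap.id (word k (u.take (i + 1)))
      (gamma k Ω (word k (u.drop (i + 1)))) := by
  rw [gamma_word, ((splittings_perm hu).map _).sum_eq, List.map_flatMap, List.flatMap_def,
    List.sum_flatten, List.map_map]
  change ((List.range u.length).map _).sum = ((List.range u.length).map _).sum
  congr 1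
  refine List.map_congr_left fun i _ => ?_
  rcases u with _ | ⟨a, u⟩
  · exact absurd rfl hu
  simp only [Function.comp_apply, gamma_word, map_list_sum, List.map_map, List.take_succ_cons]
  congr 1
  refine List.map_congr_left fun s _ => ?_
  simp [block_cons, weights]

/-- The recursion `Γ(x) = ε(x) 1 + ∑ L(x₁) Γ(x₂)`, where `L(w) = ‖w‖ · ⊗ w * ·`. -/
theorem gamma_recursion (x : QSh k Ω) : gamma k Ω x = deconcCounit k Ω x • 1 +
    TensorProduct.lift ((block (consMap k) LinearMap.id).compl₂ (gamma k Ω)) (deconc k Ω x) := by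
  have : gamma k Ω = (deconcCounit k Ω).smulRight 1 +
      TensorProduct.lift ((block (consMap k) LinearMap.id).compl₂ (gamma k Ω)) ∘ₗ
        deconc k Ω := hom_ext fun u => by
    rw [LinearMap.add_apply, LinearMap.comp_apply, lift_deconc_word _ (block_nil _ _),
      LinearMap.smulRight_apply, deconcCounit_word]
    rcases u with _ | ⟨a, u⟩
    · simp [gamma_nil]
    · rw [gamma_word_eq_sum (by simp)]; simp
  exact LinearMap.congr_fun this x

end Recursion

/-! ### The coaction on the deconcatenation coalgebra -/

section Coaction

variable [AddCommSemigroup Ω]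

/-- The map `(x ⊗ y) ⊗ (x' ⊗ y') ↦ (x ⊗ x') ⊗ y * y'`. -/
def mulSnd (k : Type*) [Field k] (Ω : Type*) [AddCommSemigroup Ω] :
    (QSh k Ω ⊗[k] QSh k Ω) ⊗[k] (QSh k Ω ⊗[k] QSh k Ω) →ₐ[k] (QSh k Ω ⊗[k] QSh k Ω) ⊗[k] QSh k Ω :=
  (Algebra.TensorProduct.map (AlgHom.id k (QSh k Ω ⊗[k] QSh k Ω))
    (Algebra.TensorProduct.lmul' k (S := QSh k Ω))).comp
    (Algebra.TensorProduct.tensorTensorTensorComm k k k k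
      (QSh k Ω) (QSh k Ω) (QSh k Ω) (QSh k Ω)).toAlgHom

theorem mulSnd_tmul (x y x' y' : QSh k Ω) :
    mulSnd k Ω ((x ⊗ₜ y) ⊗ₜ (x' ⊗ₜ y')) = (x ⊗ₜ x') ⊗ₜ (y * y') := by
  simp [mulSnd]

/-- `(ε ⊗ Id) Γ = u ε`: an operator `L(w)` produces a nonempty first factor. -/
theorem rTensor_counit_gamma (x : QSh k Ω) :
    (deconcCounit k Ω).rTensor (QSh k Ω) (gamma k Ω x) = deconcCounit k Ω x ⊗ₜ 1 := by
  have h (y : QSh k Ω) (T : QSh k Ω ⊗[k] QSh k Ω) : (deconcCounit k Ω).rTensor (QSh k Ω)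
      (block (consMap k) LinearMap.id y T) = 0 := by
    have : (block (consMap k) LinearMap.id).compr₂ ((deconcCounit k Ω).rTensor (QSh k Ω)) = 0 :=
      hom_ext fun w => by
        rcases w with _ | ⟨a, w⟩
        · ext; simp [block_nil]
        · ext; simp [block_cons, deconcCounit_consMap]
    exact LinearMap.congr_fun₂ this y T
  rw [gamma_recursion, map_add]
  have h2 (t : QSh k Ω ⊗[k] QSh k Ω) : (deconcCounit k Ω).rTensor (QSh k Ω) (TensorProduct.lift
      ((block (consMap k) LinearMap.id).compl₂ (gamma k Ω)) t) = 0 := by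
    induction t with
    | zero => simp
    | add x y hx hy => simp only [map_add, hx, hy, add_zero]
    | tmul x y => simp [h]
  rw [h2, add_zero, map_smul, Algebra.TensorProduct.one_def, LinearMap.rTensor_tmul, one_def,
    deconcCounit_word, if_pos rfl, TensorProduct.smul_tmul', smul_eq_mul, mul_one]

/-- Applying `L(x)` to the argument `S` of `mulSnd (S ⊗ T)` amounts to applying its analogue to the
result. -/
theorem mulSnd_block (x : QSh k Ω) (S T : QSh k Ω ⊗[k] QSh k Ω) :
    mulSnd k Ω (block (consMap k) LinearMap.id x S ⊗ₜ T) =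
      block (fun a => (consMap k a).rTensor _) LinearMap.id x (mulSnd k Ω (S ⊗ₜ T)) := by
  induction S with
  | zero => simp
  | add x y hx hy => simp only [map_add, TensorProduct.add_tmul, hx, hy]
  | tmul s s' =>
    induction T with
    | zero => simp
    | add x y hx hy => simp only [map_add, TensorProduct.tmul_add, hx, hy]
    | tmul t t' =>
      have : (mulSnd k Ω).toLinearMap ∘ₗ (TensorProduct.mk k _ _).flip (t ⊗ₜ t') ∘ₗ
          (block (consMap k) LinearMap.id).flip (s ⊗ₜ s') =
          (block (fun a => (consMap k a).rTensor (QSh k Ω)) LinearMap.id).flip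
            ((s ⊗ₜ t) ⊗ₜ (s' * t')) := hom_ext fun w => by
        rcases w with _ | ⟨a, w⟩
        · simp [block_nil]
        · simp [block_cons, mulSnd_tmul, mul_assoc]
      simpa [mulSnd_tmul] using LinearMap.congr_fun this x

/-- Deconcatenation after prefixing a letter: the cut before that letter gives the first term. -/
theorem rTensor_deconc_block (x : QSh k Ω) (T : QSh k Ω ⊗[k] QSh k Ω) :
    (deconc k Ω).rTensor (QSh k Ω) (block (consMap k) LinearMap.id x T) =
      (TensorProduct.mk k (QSh k Ω) (QSh k Ω) 1).rTensor (QSh k Ω)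
        (block (consMap k) LinearMap.id x T) +
      block (fun a => (consMap k a).rTensor _) LinearMap.id x
        ((deconc k Ω).rTensor (QSh k Ω) T) := by
  induction T with
  | zero => simp
  | add x y hx hy => simp only [map_add, hx, hy]; abel
  | tmul t t' =>
    have : (deconc k Ω).rTensor (QSh k Ω) ∘ₗ (block (consMap k) LinearMap.id).flip (t ⊗ₜ t') =
        (TensorProduct.mk k (QSh k Ω) (QSh k Ω) 1).rTensor (QSh k Ω) ∘ₗ
          (block (consMap k) LinearMap.id).flip (t ⊗ₜ t') +
        (block (fun a => (consMap k a).rTensor _) LinearMap.id).flip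
          ((deconc k Ω).rTensor (QSh k Ω) (t ⊗ₜ t')) := hom_ext fun w => by
      rcases w with _ | ⟨a, w⟩
      · simp [block_nil]
      · simp [block_cons, deconc_consMap, TensorProduct.add_tmul, one_def]
    exact LinearMap.congr_fun this x

theorem mulSnd_one_tmul (T : QSh k Ω ⊗[k] QSh k Ω) : mulSnd k Ω (1 ⊗ₜ T) =
    (TensorProduct.mk k (QSh k Ω) (QSh k Ω) 1).rTensor (QSh k Ω) T := by
  induction T with
  | zero => simp
  | add x y hx hy => simp only [map_add, TensorProduct.tmul_add, hx, hy]
  | tmul t t' => simp [Algebra.TensorProduct.one_def, mulSnd_tmul]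

/-- The recursion for `Γ`, applied to the first factor of `(Id ⊗ Id ⊗ *) τ₂₃ (Γ ⊗ Γ) t`. -/
theorem mulSnd_map_gamma (t : QSh k Ω ⊗[k] QSh k Ω) :
    mulSnd k Ω (TensorProduct.map (gamma k Ω) (gamma k Ω) t) =
      (TensorProduct.mk k (QSh k Ω) (QSh k Ω) 1).rTensor (QSh k Ω) (gamma k Ω
        ((TensorProduct.lid k (QSh k Ω)).toLinearMap ((deconcCounit k Ω).rTensor (QSh k Ω) t))) +
      TensorProduct.lift ((block (fun a => (consMap k a).rTensor (QSh k Ω)) LinearMap.id).compl₂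
          ((mulSnd k Ω).toLinearMap ∘ₗ TensorProduct.map (gamma k Ω) (gamma k Ω)))
        ((TensorProduct.assoc k (QSh k Ω) (QSh k Ω) (QSh k Ω)).toLinearMap
          ((deconc k Ω).rTensor (QSh k Ω) t)) := by
  induction t with
  | zero => simp only [map_zero, add_zero]
  | add x y hx hy => simp only [map_add, hx, hy]; abel
  | tmul y z =>
    rw [TensorProduct.map_tmul, gamma_recursion y, TensorProduct.add_tmul, map_add,
      ← TensorProduct.smul_tmul', map_smul, mulSnd_one_tmul]
    congr 1
    · rw [LinearMap.rTensor_tmul, LinearEquiv.coe_coe, TensorProduct.lid_tmul, map_smul, map_smul]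
    · rw [LinearMap.rTensor_tmul]
      induction deconc k Ω y with
      | zero => simp only [map_zero, TensorProduct.zero_tmul]
      | add x y hx hy => simp only [map_add, TensorProduct.add_tmul, hx, hy]
      | tmul y y' => exact mulSnd_block y _ _

/-- `(Δ ⊗ Id) Γ = (Id ⊗ Id ⊗ *) τ₂₃ (Γ ⊗ Γ) Δ`: both sides solve the recursion
`F(x) = 1 ⊗ Γ(x) + ∑ L(x₁) F(x₂)`. -/
theorem rTensor_deconc_gamma (x : QSh k Ω) :
    (deconc k Ω).rTensor (QSh k Ω) (gamma k Ω x) =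
      mulSnd k Ω (TensorProduct.map (gamma k Ω) (gamma k Ω) (deconc k Ω x)) := by
  let β : QSh k Ω →ₗ[k] (QSh k Ω ⊗[k] QSh k Ω) ⊗[k] QSh k Ω →ₗ[k] _ :=
    block (fun a => (consMap k a).rTensor (QSh k Ω)) LinearMap.id
  let N : QSh k Ω ⊗[k] QSh k Ω →ₗ[k] (QSh k Ω ⊗[k] QSh k Ω) ⊗[k] QSh k Ω :=
    (TensorProduct.mk k (QSh k Ω) (QSh k Ω) 1).rTensor (QSh k Ω)
  let F := (deconc k Ω).rTensor (QSh k Ω) ∘ₗ gamma k Ω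
  let G := (mulSnd k Ω).toLinearMap ∘ₗ TensorProduct.map (gamma k Ω) (gamma k Ω) ∘ₗ deconc k Ω
  suffices F = G from LinearMap.congr_fun this x
  refine eq_of_recursion β (block_nil _ _) (N ∘ₗ gamma k Ω) F G (fun x => ?_) fun x => ?_
  · have h (t : QSh k Ω ⊗[k] QSh k Ω) : (deconc k Ω).rTensor (QSh k Ω) (TensorProduct.lift
        ((block (consMap k) LinearMap.id).compl₂ (gamma k Ω)) t) = N (TensorProduct.lift
        ((block (consMap k) LinearMap.id).compl₂ (gamma k Ω)) t) +
          TensorProduct.lift (β.compl₂ F) t := by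
      induction t with
      | zero => simp
      | add x y hx hy => simp only [map_add, hx, hy]; abel
      | tmul t t' => exact rTensor_deconc_block t (gamma k Ω t')
    simp only [F, LinearMap.comp_apply]
    rw [gamma_recursion x, map_add, map_add, h]
    simp [N, one_def, deconc_word_nil, Algebra.TensorProduct.one_def, F, add_assoc]
  · change mulSnd k Ω (TensorProduct.map (gamma k Ω) (gamma k Ω) (deconc k Ω x)) = _
    have h3 := Coalgebra.coassoc_apply (R := k) x
    have h4 := Coalgebra.rTensor_counit_comul (R := k) x
    rw [comul_def] at h3 h4
    rw [counit_def] at h4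
    rw [mulSnd_map_gamma, h4, LinearEquiv.coe_coe, LinearEquiv.coe_coe, h3,
      TensorProduct.lid_tmul, one_smul]
    congr 1
    induction deconc k Ω x with
    | zero => simp only [map_zero]
    | add x y hx hy => simp only [map_add, hx, hy]
    | tmul y z => simp [G, β]

end Coaction

/-! ### Compatibility with the quasi-shuffle product -/

section Multiplicative

variable [AddCommSemigroup Ω]

/-- The span of the nonempty words of weight `c`. -/
def ofWeight (k : Type*) [Field k] {Ω : Type*} [AddCommSemigroup Ω] (c : Ω) :
    Submodule k (QSh k Ω) :=
  Submodule.span k {x | ∃ a w, weight a w = c ∧ x = word k (a :: w)}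

theorem word_mem_ofWeight (a : Ω) (w : List Ω) : word k (a :: w) ∈ ofWeight k (weight a w) :=
  Submodule.subset_span ⟨a, w, rfl, rfl⟩

theorem consMap_mem_ofWeight (a : Ω) {c : Ω} {x : QSh k Ω} (hx : x ∈ ofWeight k c) :
    consMap k a x ∈ ofWeight k (a + c) := by
  induction hx using Submodule.span_induction with
  | mem x hx =>
    obtain ⟨b, w, rfl, rfl⟩ := hx
    rw [consMap_word]
    exact word_mem_ofWeight a (b :: w)
  | zero => rw [map_zero]; exact zero_mem _
  | add x y _ _ hx hy => rw [map_add]; exact add_mem hx hy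
  | smul r x _ hx => rw [map_smul]; exact Submodule.smul_mem _ r hx

theorem qsh_mem_ofWeight (a b : Ω) (w z : List Ω) :
    qsh k (a :: w) (b :: z) ∈ ofWeight k (weight a w + weight b z) := by
  rw [qsh]
  refine add_mem (add_mem ?_ ?_) ?_
  · rcases w with _ | ⟨c, w⟩
    · rw [qsh_nil_left, consMap_word]
      exact word_mem_ofWeight a (b :: z)
    · rw [weight, add_assoc]
      exact consMap_mem_ofWeight a (qsh_mem_ofWeight c b w z)
  · rcases z with _ | ⟨d, z⟩
    · rw [qsh_nil_right, consMap_word, add_comm]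
      exact word_mem_ofWeight b (a :: w)
    · rw [weight, add_left_comm]
      exact consMap_mem_ofWeight b (qsh_mem_ofWeight a d w z)
  · rcases w with _ | ⟨c, w⟩
    · rw [qsh_nil_left, consMap_word]
      rcases z with _ | ⟨d, z⟩
      · exact word_mem_ofWeight (a + b) []
      · rw [weight, weight, ← add_assoc]
        exact word_mem_ofWeight (a + b) (d :: z)
    · rcases z with _ | ⟨d, z⟩
      · rw [qsh_nil_right, consMap_word, weight, weight, add_right_comm]
        exact word_mem_ofWeight (a + b) (c :: w)
      · rw [weight, weight, add_add_add_comm]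
        exact consMap_mem_ofWeight (a + b) (qsh_mem_ofWeight c d w z)
termination_by w.length + z.length
decreasing_by all_goals (simp only [List.length_cons]; omega)

theorem block_of_mem_ofWeight {V : Type*} [AddCommGroup V] [Module k V]
    {A : Type*} [Ring A] [Algebra k A] (f : Ω → V →ₗ[k] V) (φ : QSh k Ω →ₗ[k] A) {c : Ω}
    {x : QSh k Ω} (hx : x ∈ ofWeight k c) :
    block f φ x = TensorProduct.map (f c) (LinearMap.mulLeft k (φ x)) := by
  induction hx using Submodule.span_induction with
  | mem x hx =>
    obtain ⟨b, w, rfl, rfl⟩ := hx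
    exact block_cons f φ b w
  | zero => ext; simp
  | add x y _ _ hx hy => rw [map_add, hx, hy]; ext; simp [add_mul, TensorProduct.tmul_add]
  | smul r x _ hx => rw [map_smul, hx]; ext; simp

/-- The operators `L(w)` obey the rule by which the letters `‖w‖` are multiplied in the
quasi-shuffle product. -/
theorem block_mul_block {w z : List Ω} (hw : w ≠ []) (hz : z ≠ [])
    (S T : QSh k Ω ⊗[k] QSh k Ω) :
    block (consMap k) LinearMap.id (word k w) S * block (consMap k) LinearMap.id (word k z) T =
      block (consMap k) LinearMap.id (word k w) (S * block (consMap k) LinearMap.id (word k z) T)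
      + block (consMap k) LinearMap.id (word k z)
          (block (consMap k) LinearMap.id (word k w) S * T)
      + block (consMap k) LinearMap.id (word k w * word k z) (S * T) := by
  obtain ⟨a, w, rfl⟩ := List.exists_cons_of_ne_nil hw
  obtain ⟨b, z, rfl⟩ := List.exists_cons_of_ne_nil hz
  have h := qsh_mem_ofWeight (k := k) a b w z
  rw [← word_mul_word] at h
  rw [block_cons, block_cons, block_of_mem_ofWeight _ _ h]
  generalize word k (a :: w) = x
  generalize word k (b :: z) = y
  induction S with
  | zero => simp only [map_zero, zero_mul, add_zero]
  | add S S' h h' => simp only [map_add, add_mul, h, h']; abel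
  | tmul s s' =>
    induction T with
    | zero => simp only [map_zero, mul_zero, add_zero]
    | add S S' h h' => simp only [map_add, mul_add, h, h']; abel
    | tmul t t' =>
      simp only [TensorProduct.map_tmul, Algebra.TensorProduct.tmul_mul_tmul,
        LinearMap.mulLeft_apply, LinearMap.id_apply, consMap_mul_consMap, TensorProduct.add_tmul]
      rw [show s' * (y * t') = y * (s' * t') from mul_left_comm _ _ _,
        show x * s' * t' = x * (s' * t') from mul_assoc _ _ _,
        show x * s' * (y * t') = x * y * (s' * t') from mul_mul_mul_comm _ _ _ _,
        show x * (y * (s' * t')) = x * y * (s' * t') from (mul_assoc _ _ _).symm,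
        show y * (x * (s' * t')) = x * y * (s' * t') from by rw [← mul_assoc, mul_comm y x]]

/-- `Γ` is multiplicative on words, by induction on the total length, expanding both sides over
first blocks. -/
theorem gamma_mul_word (u v : List Ω) :
    gamma k Ω (word k u * word k v) = gamma k Ω (word k u) * gamma k Ω (word k v) := by
  induction h : u.length + v.length using Nat.strong_induction_on generalizing u v with
  | _ n ih =>
    subst h
    by_cases hu : u = []
    · rw [hu, gamma_nil, ← one_def, one_mul, one_mul]
    by_cases hv : v = []
    · rw [hv, gamma_nil, ← one_def, mul_one, mul_one]
    rw [gamma_recursion (word k u * word k v), deconcCounit_mul, deconcCounit_word, if_neg hu,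
      zero_mul, zero_smul, zero_add, deconc_mul, deconc_word_eq_add u, deconc_word_eq_add v]
    simp only [add_mul, mul_add, Finset.sum_mul, Finset.mul_sum, map_add, map_sum,
      Algebra.TensorProduct.tmul_mul_tmul, TensorProduct.lift.tmul, LinearMap.compl₂_apply,
      ← one_def, one_mul, mul_one]
    rw [one_def, block_nil, LinearMap.zero_apply, zero_add]
    have hU (i) (hi : i ∈ Finset.range u.length) : u.take (i + 1) ≠ [] := by simp [hu]
    have hV (i) (hi : i ∈ Finset.range v.length) : v.take (i + 1) ≠ [] := by simp [hv]
    have e1 (i) (hi : i ∈ Finset.range u.length) :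
        gamma k Ω (word k (u.drop (i + 1)) * word k v) =
          gamma k Ω (word k (u.drop (i + 1))) * gamma k Ω (word k v) :=
      ih _ (by simp at hi ⊢; omega) _ _ rfl
    have e2 (j) (hj : j ∈ Finset.range v.length) :
        gamma k Ω (word k u * word k (v.drop (j + 1))) =
          gamma k Ω (word k u) * gamma k Ω (word k (v.drop (j + 1))) :=
      ih _ (by simp at hj ⊢; omega) _ _ rfl
    have e3 (i) (hi : i ∈ Finset.range u.length) (j) (hj : j ∈ Finset.range v.length) :
        gamma k Ω (word k (u.drop (i + 1)) * word k (v.drop (j + 1))) =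
          gamma k Ω (word k (u.drop (i + 1))) * gamma k Ω (word k (v.drop (j + 1))) :=
      ih _ (by simp at hi hj ⊢; omega) _ _ rfl
    have r : gamma k Ω (word k u) * gamma k Ω (word k v) =
        ∑ i ∈ Finset.range u.length, ∑ j ∈ Finset.range v.length,
          block (consMap k) LinearMap.id (word k (u.take (i + 1)))
            (gamma k Ω (word k (u.drop (i + 1)))) *
          block (consMap k) LinearMap.id (word k (v.take (j + 1)))
            (gamma k Ω (word k (v.drop (j + 1)))) := by
      rw [gamma_word_eq_sum hu, gamma_word_eq_sum hv, Finset.sum_mul_sum]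
    rw [r, Finset.sum_congr rfl fun i hi => Finset.sum_congr rfl fun j hj =>
      block_mul_block (hU i hi) (hV j hj) _ _]
    simp only [Finset.sum_add_distrib]
    rw [Finset.sum_comm (f := fun i j => block (consMap k) LinearMap.id
        (word k (v.take (j + 1))) _)]
    simp only [← map_sum, ← Finset.mul_sum, ← Finset.sum_mul]
    rw [← gamma_word_eq_sum hu, ← gamma_word_eq_sum hv]
    rw [Finset.sum_congr rfl fun i hi => congrArg _ (e1 i hi),
      Finset.sum_congr rfl fun j hj => congrArg _ (e2 j hj), add_assoc, Finset.sum_comm,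
      Finset.sum_congr rfl fun i hi => Finset.sum_congr rfl fun j hj => congrArg _ (e3 i hi j hj)]

theorem gamma_mul (x y : QSh k Ω) : gamma k Ω (x * y) = gamma k Ω x * gamma k Ω y := by
  have : (LinearMap.mul k (QSh k Ω)).compr₂ (gamma k Ω) =
      (LinearMap.mul k (QSh k Ω ⊗[k] QSh k Ω)).compl₁₂ (gamma k Ω) (gamma k Ω) :=
    hom_ext fun u => hom_ext fun v => gamma_mul_word u v
  exact LinearMap.congr_fun₂ this x y

/-- `Γ` as a morphism of algebras. -/
def gammaAlgHom (k : Type*) [Field k] (Ω : Type*) [AddCommSemigroup Ω] :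
    QSh k Ω →ₐ[k] QSh k Ω ⊗[k] QSh k Ω :=
  AlgHom.ofLinearMap (gamma k Ω) gamma_nil gamma_mul

end Multiplicative

variable [AddCommSemigroup Ω]

/-! ### Coassociativity -/

section Coassociativity

theorem weight_append (a b : Ω) (u v : List Ω) :
    weight a (u ++ b :: v) = weight a u + weight b v := by
  induction u generalizing a with
  | nil => rfl
  | cons c u ih => rw [List.cons_append, weight, ih, weight, add_assoc]

/-- Merging the blocks of a splitting does not change the weight. -/
theorem exists_weights_eq_cons {a : Ω} {u : List Ω} {s : List (List Ω)}
    (hs : s ∈ splittings (a :: u)) : ∃ b v, weights s = b :: v ∧ weight b v = weight a u := by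
  induction s generalizing a u with
  | nil => simp [mem_splittings] at hs
  | cons w s ih =>
    obtain ⟨h1, h2⟩ := (mem_splittings _ _).1 hs
    rcases w with _ | ⟨c, w⟩
    · simp at h2
    simp only [List.flatten_cons, List.cons_append, List.cons.injEq] at h1
    obtain ⟨rfl, rfl⟩ := h1
    refine ⟨weight c w, weights s, rfl, ?_⟩
    rcases h : s.flatten with _ | ⟨d, v⟩
    · have : s = [] := by
        rcases s with _ | ⟨x, s⟩
        · rfl
        · simp only [List.flatten_cons, List.append_eq_nil_iff] at h
          simp [h.1] at h2
      simp [this, weights, weight]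
    · obtain ⟨e, x, h3, h4⟩ := ih ((mem_splittings (d :: v) s).2 ⟨h, by simp_all⟩)
      rw [h3, weight_append, weight, h4]

/-- For a word `x`, all words in the first tensor factor of `Γ(x)` have the weight of `x`, so that the
operator `L` of the recursion acts through that single weight. -/
theorem block_mulSnd_gamma (x : QSh k Ω) (T : QSh k Ω ⊗[k] QSh k Ω) :
    (TensorProduct.assoc k (QSh k Ω) (QSh k Ω) (QSh k Ω)).toLinearMap ((TensorProduct.lift
      ((block (consMap k) LinearMap.id).compl₂ (gamma k Ω))).rTensor (QSh k Ω)
        (mulSnd k Ω (gamma k Ω x ⊗ₜ T))) =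
      block (consMap k) (gamma k Ω) x
        ((TensorProduct.assoc k (QSh k Ω) (QSh k Ω) (QSh k Ω)).toLinearMap
          ((gamma k Ω).rTensor (QSh k Ω) T)) := by
  induction T with
  | zero => simp only [map_zero, TensorProduct.tmul_zero]
  | add S T hS hT => simp only [map_add, TensorProduct.tmul_add, hS, hT]
  | tmul y z =>
    let Φ : QSh k Ω ⊗[k] QSh k Ω →ₗ[k] QSh k Ω ⊗[k] (QSh k Ω ⊗[k] QSh k Ω) :=
      (TensorProduct.assoc k (QSh k Ω) (QSh k Ω) (QSh k Ω)).toLinearMap ∘ₗ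
      (TensorProduct.lift ((block (consMap k) LinearMap.id).compl₂ (gamma k Ω))).rTensor (QSh k Ω)
        ∘ₗ (mulSnd k Ω).toLinearMap ∘ₗ (TensorProduct.mk k _ _).flip (y ⊗ₜ z)
    have key (b : Ω) (v : List Ω) (p : QSh k Ω) (S : QSh k Ω ⊗[k] QSh k Ω) :
        (TensorProduct.assoc k (QSh k Ω) (QSh k Ω) (QSh k Ω)).toLinearMap
          (block (consMap k) LinearMap.id (word k (b :: v)) S ⊗ₜ (p * z)) =
        TensorProduct.map (consMap k (weight b v)) (LinearMap.mulLeft k (word k (b :: v) ⊗ₜ p))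
          ((TensorProduct.assoc k (QSh k Ω) (QSh k Ω) (QSh k Ω)).toLinearMap (S ⊗ₜ z)) := by
      rw [block_cons]
      induction S with
      | zero => simp only [map_zero, TensorProduct.zero_tmul]
      | add S T hS hT => simp only [map_add, TensorProduct.add_tmul, hS, hT]
      | tmul s s' => simp
    have : Φ ∘ₗ gamma k Ω = (block (consMap k) (gamma k Ω)).flip
        ((TensorProduct.assoc k (QSh k Ω) (QSh k Ω) (QSh k Ω)).toLinearMap
          (gamma k Ω y ⊗ₜ z)) := hom_ext fun w => by
      rw [LinearMap.flip_apply, LinearMap.comp_apply]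
      rcases w with _ | ⟨a, w⟩
      · rw [block_nil, gamma_nil, Algebra.TensorProduct.one_def]
        simp only [Φ, LinearMap.comp_apply, LinearMap.flip_apply, TensorProduct.mk_apply,
          AlgHom.toLinearMap_apply, mulSnd_tmul, LinearMap.rTensor_tmul, TensorProduct.lift.tmul,
          LinearMap.compl₂_apply, one_def, block_nil, LinearMap.zero_apply,
          TensorProduct.zero_tmul, map_zero]
      · rw [block_cons]
        generalize hW : (TensorProduct.assoc k (QSh k Ω) (QSh k Ω) (QSh k Ω)).toLinearMap
          (gamma k Ω y ⊗ₜ z) = W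
        -- Every splitting of `a :: w` contributes through the operator of weight `‖a :: w‖`.
        have hl (l : List (List (List Ω))) (hl : ∀ s ∈ l, s ∈ splittings (a :: w)) :
            Φ (l.map fun s => word k (weights s) ⊗ₜ[k] (s.map (word k)).prod).sum =
              TensorProduct.map (consMap k (weight a w)) (LinearMap.mulLeft k
                (l.map fun s => word k (weights s) ⊗ₜ[k] (s.map (word k)).prod).sum) W := by
          induction l with
          | nil => simp
          | cons s l ih =>
            obtain ⟨b, v, h1, h2⟩ := exists_weights_eq_cons (hl s (by simp))
            have hadd (X Y : QSh k Ω ⊗[k] QSh k Ω) : LinearMap.mulLeft k (X + Y) =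
                LinearMap.mulLeft k X + LinearMap.mulLeft k Y := map_add (LinearMap.mul k _) X Y
            rw [List.map_cons, List.sum_cons, map_add, ih fun t ht => hl t (by simp [ht]), hadd,
              TensorProduct.map_add_right, LinearMap.add_apply, h1, ← h2, ← hW, ← key]
            simp only [Φ, LinearMap.comp_apply, LinearMap.flip_apply, TensorProduct.mk_apply,
              AlgHom.toLinearMap_apply, mulSnd_tmul, LinearMap.rTensor_tmul,
              TensorProduct.lift.tmul, LinearMap.compl₂_apply]
        rw [gamma_word]
        exact hl _ fun _ h => h
    exact LinearMap.congr_fun this x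

/-- Coassociativity of `Γ`: both sides solve the recursion `F(x) = ε(x) 1 + ∑ M(x₁) F(x₂)`, where
`M(w) = ‖w‖ · ⊗ Γ(w) * ·`. -/
theorem assoc_rTensor_gamma_gamma (x : QSh k Ω) :
    TensorProduct.assoc k _ _ _ ((gamma k Ω).rTensor (QSh k Ω) (gamma k Ω x)) =
      (gamma k Ω).lTensor (QSh k Ω) (gamma k Ω x) := by
  let F := (TensorProduct.assoc k (QSh k Ω) (QSh k Ω) (QSh k Ω)).toLinearMap ∘ₗ
    (gamma k Ω).rTensor (QSh k Ω) ∘ₗ gamma k Ω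
  let G := (gamma k Ω).lTensor (QSh k Ω) ∘ₗ gamma k Ω
  suffices F = G from LinearMap.congr_fun this x
  refine eq_of_recursion (block (consMap k) (gamma k Ω)) (block_nil _ _)
    ((deconcCounit k Ω).smulRight 1) F G (fun x => ?_) fun x => ?_
  · let J := TensorProduct.lift ((block (consMap k) LinearMap.id).compl₂ (gamma k Ω))
    have h1 (T : QSh k Ω ⊗[k] QSh k Ω) : (gamma k Ω).rTensor (QSh k Ω) T =
        (1 : QSh k Ω ⊗[k] QSh k Ω) ⊗ₜ[k]
          (TensorProduct.lid k (QSh k Ω) ((deconcCounit k Ω).rTensor (QSh k Ω) T)) +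
        J.rTensor (QSh k Ω) ((deconc k Ω).rTensor (QSh k Ω) T) := by
      induction T with
      | zero => simp only [map_zero, TensorProduct.tmul_zero, add_zero]
      | add S T hS hT => simp only [map_add, TensorProduct.tmul_add, hS, hT]; abel
      | tmul s t =>
        rw [LinearMap.rTensor_tmul, gamma_recursion s, TensorProduct.add_tmul]
        simp [J, TensorProduct.smul_tmul']
    have h2 (t : QSh k Ω ⊗[k] QSh k Ω) :
        (TensorProduct.assoc k (QSh k Ω) (QSh k Ω) (QSh k Ω)).toLinearMap (J.rTensor (QSh k Ω)
          (mulSnd k Ω (TensorProduct.map (gamma k Ω) (gamma k Ω) t))) =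
        TensorProduct.lift ((block (consMap k) (gamma k Ω)).compl₂ F) t := by
      induction t with
      | zero => simp only [map_zero]
      | add S T hS hT => simp only [map_add, hS, hT]
      | tmul s t => exact block_mulSnd_gamma s (gamma k Ω t)
    rw [← h2, ← rTensor_deconc_gamma]
    change (TensorProduct.assoc k (QSh k Ω) (QSh k Ω) (QSh k Ω)).toLinearMap
      ((gamma k Ω).rTensor (QSh k Ω) (gamma k Ω x)) = _
    rw [h1, map_add, rTensor_counit_gamma]
    congr 1
    simp [Algebra.TensorProduct.one_def]
  · have h (y : QSh k Ω) (T : QSh k Ω ⊗[k] QSh k Ω) :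
        (gamma k Ω).lTensor (QSh k Ω) (block (consMap k) LinearMap.id y T) =
          block (consMap k) (gamma k Ω) y ((gamma k Ω).lTensor (QSh k Ω) T) := by
      have : (block (consMap k) LinearMap.id).compr₂ ((gamma k Ω).lTensor (QSh k Ω)) =
          (block (consMap k) (gamma k Ω)).compl₂ ((gamma k Ω).lTensor (QSh k Ω)) :=
        hom_ext fun w => by
          rcases w with _ | ⟨a, w⟩
          · ext; simp [block_nil]
          · ext; simp [block_cons, gamma_mul]
      exact LinearMap.congr_fun₂ this y T
    have h2 (t : QSh k Ω ⊗[k] QSh k Ω) : (gamma k Ω).lTensor (QSh k Ω) (TensorProduct.lift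
        ((block (consMap k) LinearMap.id).compl₂ (gamma k Ω)) t) =
        TensorProduct.lift ((block (consMap k) (gamma k Ω)).compl₂ G) t := by
      induction t with
      | zero => simp only [map_zero]
      | add S T hS hT => simp only [map_add, hS, hT]
      | tmul s t => exact h s (gamma k Ω t)
    rw [← h2]
    change (gamma k Ω).lTensor (QSh k Ω) (gamma k Ω x) = _
    rw [gamma_recursion x, map_add, map_smul, Algebra.TensorProduct.one_def,
      LinearMap.lTensor_tmul]
    congr 1
    rw [one_def, gamma_nil]
    rfl

end Coassociativity

/-! ### The counit -/

section Counit

/-- The counit `η` of `Γ`: `1` on words of length at most one and `0` on all others. -/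
def gammaCounit (k : Type*) [Field k] (Ω : Type*) : QSh k Ω →ₗ[k] k :=
  (wordBasis k Ω).constr k fun u => if u.length ≤ 1 then 1 else 0

theorem gammaCounit_nil : gammaCounit k Ω (1 : QSh k Ω) = 1 := by
  simp only [gammaCounit, one_def, word, Module.Basis.constr_basis]
  simp

omit [AddCommSemigroup Ω] in
theorem gammaCounit_consMap (a : Ω) (x : QSh k Ω) :
    gammaCounit k Ω (consMap k a x) = deconcCounit k Ω x := by
  have : gammaCounit k Ω ∘ₗ consMap k a = deconcCounit k Ω := hom_ext fun u => by
    rw [LinearMap.comp_apply, consMap_word, deconcCounit_word]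
    simp only [gammaCounit, word, Module.Basis.constr_basis]
    simp
  exact LinearMap.congr_fun this x

theorem gammaCounit_mul (x y : QSh k Ω) :
    gammaCounit k Ω (x * y) = gammaCounit k Ω x * gammaCounit k Ω y := by
  have : (LinearMap.mul k (QSh k Ω)).compr₂ (gammaCounit k Ω) =
      (LinearMap.mul k k).compl₁₂ (gammaCounit k Ω) (gammaCounit k Ω) :=
    hom_ext fun u => hom_ext fun v => by
      simp only [LinearMap.compr₂_apply, LinearMap.mul_apply', LinearMap.compl₁₂_apply]
      rcases u with _ | ⟨a, u⟩
      · rw [← one_def, gammaCounit_nil, one_mul, one_mul]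
      rcases v with _ | ⟨b, v⟩
      · rw [← one_def, gammaCounit_nil, mul_one, mul_one]
      rw [← consMap_word, ← consMap_word, consMap_mul_consMap]
      simp only [map_add, gammaCounit_consMap, deconcCounit_mul, deconcCounit_consMap]
      simp
  exact LinearMap.congr_fun₂ this x y

/-- `η` as a morphism of algebras. -/
def gammaCounitAlgHom (k : Type*) [Field k] (Ω : Type*) [AddCommSemigroup Ω] : QSh k Ω →ₐ[k] k :=
  AlgHom.ofLinearMap (gammaCounit k Ω) gammaCounit_nil gammaCounit_mul

/-- `(η ⊗ Id) Γ = Id`: only the splitting with a single block contributes. -/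
theorem rTensor_gammaCounit_gamma (x : QSh k Ω) :
    (gammaCounit k Ω).rTensor (QSh k Ω) (gamma k Ω x) = 1 ⊗ₜ x := by
  suffices (gammaCounit k Ω).rTensor (QSh k Ω) ∘ₗ gamma k Ω = TensorProduct.mk k k (QSh k Ω) 1 from
    LinearMap.congr_fun this x
  refine hom_ext fun u => ?_
  rw [LinearMap.comp_apply, TensorProduct.mk_apply]
  rcases u with _ | ⟨a, w⟩
  · rw [gamma_nil, Algebra.TensorProduct.one_def, LinearMap.rTensor_tmul, gammaCounit_nil, one_def]
  have h (v v' : List Ω) : (gammaCounit k Ω).rTensor (QSh k Ω)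
      (block (consMap k) LinearMap.id (word k (a :: v)) (gamma k Ω (word k v'))) =
        deconcCounit k Ω (word k v') ⊗ₜ word k (a :: v) := by
    have h1 : deconcCounit k Ω (word k v') ⊗ₜ[k] word k (a :: v) =
        (LinearMap.mulLeft k (word k (a :: v))).lTensor k
          (deconcCounit k Ω (word k v') ⊗ₜ (1 : QSh k Ω)) := by
      rw [LinearMap.lTensor_tmul, LinearMap.mulLeft_apply, mul_one]
    rw [h1, ← rTensor_counit_gamma, block_cons]
    generalize gamma k Ω (word k v') = T
    induction T with
    | zero => simp only [map_zero]
    | add S T hS hT => simp only [map_add, hS, hT]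
    | tmul s t => simp [gammaCounit_consMap]
  rw [gamma_word_eq_sum (by simp), map_sum, List.length_cons, Finset.sum_range_succ,
    Finset.sum_eq_zero fun i hi => ?_, zero_add]
  · simp only [List.take_succ_cons, List.drop_succ_cons, h]
    simp [deconcCounit_word]
  · simp only [List.take_succ_cons, List.drop_succ_cons, h]
    have := Finset.mem_range.1 hi
    rw [deconcCounit_word, if_neg (by simpa using this), TensorProduct.zero_tmul]

/-- `(Id ⊗ η) Γ = Id`: only the splitting into letters contributes. -/
theorem lTensor_gammaCounit_gamma (x : QSh k Ω) :
    (gammaCounit k Ω).lTensor (QSh k Ω) (gamma k Ω x) = x ⊗ₜ 1 := by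
  suffices (gammaCounit k Ω).lTensor (QSh k Ω) ∘ₗ gamma k Ω =
      (TensorProduct.mk k (QSh k Ω) k).flip 1 from LinearMap.congr_fun this x
  refine hom_ext fun u => ?_
  rw [LinearMap.comp_apply, LinearMap.flip_apply, TensorProduct.mk_apply]
  induction u with
  | nil =>
    rw [gamma_nil, Algebra.TensorProduct.one_def, LinearMap.lTensor_tmul, gammaCounit_nil, one_def]
  | cons a w ih =>
    have h (v : List Ω) (T : QSh k Ω ⊗[k] QSh k Ω) : (gammaCounit k Ω).lTensor (QSh k Ω)
        (block (consMap k) LinearMap.id (word k (a :: v)) T) = deconcCounit k Ω (word k v) •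
          (consMap k (weight a v)).rTensor k ((gammaCounit k Ω).lTensor (QSh k Ω) T) := by
      rw [block_cons]
      induction T with
      | zero => simp only [map_zero, smul_zero]
      | add S T hS hT => simp only [map_add, smul_add, hS, hT]
      | tmul s t =>
        rw [TensorProduct.map_tmul, LinearMap.lTensor_tmul, LinearMap.lTensor_tmul,
          LinearMap.rTensor_tmul, LinearMap.mulLeft_apply, gammaCounit_mul, LinearMap.id_apply,
          ← consMap_word, gammaCounit_consMap, ← smul_eq_mul, TensorProduct.tmul_smul]
    rw [gamma_word_eq_sum (by simp), map_sum, List.length_cons, Finset.sum_range_succ',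
      Finset.sum_eq_zero fun i hi => ?_, zero_add]
    · simp only [List.take_succ_cons, List.drop_succ_cons, h, List.take_zero, List.drop_zero, ih]
      simp [deconcCounit_word, weight]
    · have := Finset.mem_range.1 hi
      have hw : w ≠ [] := by rintro rfl; simp at this
      simp only [List.take_succ_cons, h]
      rw [deconcCounit_word, if_neg (by simpa using hw), zero_smul]

end Counit

/-! ### The antipode and noncocommutativity -/

section Antipode

open WithConv in
/-- `Γ ∘ S` and `(S ⊗ Id) ∘ Γ` are a left and a right inverse of `Γ` for the convolution product of
linear maps from `(H^Ω, Δ)` to `H^Ω ⊗ H^Ω`. -/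
theorem map_antipode_comp_gamma :
    (Algebra.TensorProduct.map (HopfAlgebra.antipodeAlgHom k (QSh k Ω))
        (AlgHom.id k (QSh k Ω))).comp (gammaAlgHom k Ω) =
      (gammaAlgHom k Ω).comp (HopfAlgebra.antipodeAlgHom k (QSh k Ω)) := by
  have hm (t : QSh k Ω ⊗[k] QSh k Ω) : LinearMap.mul' k (QSh k Ω ⊗[k] QSh k Ω)
      (TensorProduct.map (gamma k Ω)
        ((HopfAlgebra.antipode k (A := QSh k Ω)).rTensor (QSh k Ω) ∘ₗ gamma k Ω) t) =
      (LinearMap.mul' k (QSh k Ω) ∘ₗ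
        (HopfAlgebra.antipode k (A := QSh k Ω)).lTensor (QSh k Ω)).rTensor (QSh k Ω)
        (mulSnd k Ω (TensorProduct.map (gamma k Ω) (gamma k Ω) t)) := by
    induction t with
    | zero => simp only [map_zero]
    | add S T hS hT => simp only [map_add, hS, hT]
    | tmul s t =>
      rw [TensorProduct.map_tmul, TensorProduct.map_tmul, LinearMap.comp_apply]
      generalize gamma k Ω s = S
      generalize gamma k Ω t = T
      induction S with
      | zero => simp only [map_zero, TensorProduct.zero_tmul]
      | add S S' hS hS' => simp only [map_add, TensorProduct.add_tmul, hS, hS']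
      | tmul s s' =>
        induction T with
        | zero => simp only [map_zero, TensorProduct.tmul_zero]
        | add S S' hS hS' => simp only [map_add, TensorProduct.tmul_add, hS, hS']
        | tmul t t' => simp [mulSnd_tmul]
  have hS (T : QSh k Ω ⊗[k] QSh k Ω) : (LinearMap.mul' k (QSh k Ω) ∘ₗ
        (HopfAlgebra.antipode k (A := QSh k Ω)).lTensor (QSh k Ω)).rTensor (QSh k Ω)
        ((deconc k Ω).rTensor (QSh k Ω) T) =
      (Algebra.linearMap k (QSh k Ω)).rTensor (QSh k Ω)
        ((deconcCounit k Ω).rTensor (QSh k Ω) T) := by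
    induction T with
    | zero => simp only [map_zero]
    | add S T hS hT => simp only [map_add, hS, hT]
    | tmul s t =>
      have := HopfAlgebra.mul_antipode_lTensor_comul_apply (R := k) s
      rw [comul_def, counit_def] at this
      simp only [LinearMap.rTensor_tmul, LinearMap.comp_apply, this, Algebra.linearMap_apply]
  have hr : toConv (gamma k Ω) *
      toConv ((HopfAlgebra.antipode k (A := QSh k Ω)).rTensor (QSh k Ω) ∘ₗ gamma k Ω) = 1 := by
    refine WithConv.ext (LinearMap.ext fun x => ?_)
    change LinearMap.mul' k (QSh k Ω ⊗[k] QSh k Ω) (TensorProduct.map (gamma k Ω)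
        ((HopfAlgebra.antipode k (A := QSh k Ω)).rTensor (QSh k Ω) ∘ₗ gamma k Ω)
          (deconc k Ω x)) = algebraMap k _ (deconcCounit k Ω x)
    rw [hm, ← rTensor_deconc_gamma, hS, rTensor_counit_gamma, LinearMap.rTensor_tmul,
      Algebra.linearMap_apply, Algebra.TensorProduct.algebraMap_apply]
  have hl : toConv (gamma k Ω ∘ₗ HopfAlgebra.antipode k (A := QSh k Ω)) *
      toConv (gamma k Ω) = 1 := by
    have := LinearMap.algHom_comp_convMul_distrib (gammaAlgHom k Ω)
      (toConv (HopfAlgebra.antipode k (A := QSh k Ω))) (toConv LinearMap.id)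
    rw [LinearMap.antipode_mul_id] at this
    refine WithConv.ext (this.symm.trans (LinearMap.ext fun x => ?_))
    exact (gammaAlgHom k Ω).commutes _
  have h' := left_inv_eq_right_inv
    (M := WithConv (QSh k Ω →ₗ[k] QSh k Ω ⊗[k] QSh k Ω)) hl hr
  exact AlgHom.toLinearMap_injective (congrArg ofConv h').symm

end Antipode

section Cocommutative

/-- For letters `a ≠ b`, the coefficient of `ab ⊗ ba` is `1` in `Γ(ab)` and `0` in its flip. -/
theorem comm_comp_gamma_ne [Nontrivial Ω] :
    (TensorProduct.comm k (QSh k Ω) (QSh k Ω)).toLinearMap ∘ₗ gamma k Ω ≠ gamma k Ω := by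
  intro h
  obtain ⟨a, b, hab⟩ := exists_pair_ne Ω
  have h1 : gamma k Ω (word k [a, b]) = word k [a + b] ⊗ₜ word k [a, b] +
      word k [a, b] ⊗ₜ (word k [a, b] + word k [b, a] + word k [a + b]) := by
    have : word k [a] * word k [b] = word k [a, b] + word k [b, a] + word k [a + b] := by
      simp [word_mul_word, qsh]
    rw [← this, gamma_word]
    simp [splittings, weights, weight, add_comm]
  have h2 := LinearMap.congr_fun h (word k [a, b])
  rw [LinearMap.comp_apply, h1] at h2
  classical
  have coord (u v : List Ω) : (wordBasis k Ω).repr (word k v) u = if v = u then 1 else 0 := by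
    rw [word, Module.Basis.repr_self, Finsupp.single_apply]
  replace h2 := congrArg (LinearMap.mul' k k ∘ TensorProduct.map ((wordBasis k Ω).coord [a, b])
    ((wordBasis k Ω).coord [b, a])) h2
  simp [coord, hab, Ne.symm hab] at h2

end Cocommutative

end QSh

end

theorem theorem3p1 (k : Type*) [Field k] (Ω : Type*) [AddCommSemigroup Ω] :
    -- `Γ` is noncocommutative
    (Nontrivial Ω →
      (TensorProduct.comm k (QSh k Ω) (QSh k Ω)).toLinearMap ∘ₗ QSh.gamma k Ω ≠ QSh.gamma k Ω) ∧
    -- `Γ` is compatible with the quasi-shuffle product: it is a morphism of unital algebras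
    ∃ Γ : QSh k Ω →ₐ[k] QSh k Ω ⊗[k] QSh k Ω, Γ.toLinearMap = QSh.gamma k Ω ∧
      -- `Γ` is coassociative (hence also coassociative as a right coaction on `H^Ω`)
      (Algebra.TensorProduct.assoc k k k (QSh k Ω) (QSh k Ω) (QSh k Ω)).toAlgHom.comp
          ((Algebra.TensorProduct.map Γ (AlgHom.id k (QSh k Ω))).comp Γ) =
        (Algebra.TensorProduct.map (AlgHom.id k (QSh k Ω)) Γ).comp Γ ∧
      -- `Γ` has a counit `η` which is an algebra morphism, so that `(H^Ω, quasi-shuffle, Γ, η)` is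
      -- a bialgebra and the right coaction `Γ` is counital
      (∃ η : QSh k Ω →ₐ[k] k,
        (Algebra.TensorProduct.map η (AlgHom.id k (QSh k Ω))).comp Γ =
          (Algebra.TensorProduct.lid k (QSh k Ω)).symm.toAlgHom ∧
        (Algebra.TensorProduct.map (AlgHom.id k (QSh k Ω)) η).comp Γ =
          (Algebra.TensorProduct.rid k k (QSh k Ω)).symm.toAlgHom) ∧
      -- `(Δ ⊗ Id) Γ = (Id ⊗ Id ⊗ product) τ₂₃ (Γ ⊗ Γ) Δ`
      (Algebra.TensorProduct.map (Bialgebra.comulAlgHom k (QSh k Ω))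
          (AlgHom.id k (QSh k Ω))).comp Γ =
        (Algebra.TensorProduct.map (AlgHom.id k (QSh k Ω ⊗[k] QSh k Ω))
            (Algebra.TensorProduct.lmul' k (S := QSh k Ω))).comp
          ((Algebra.TensorProduct.tensorTensorTensorComm k k k k
              (QSh k Ω) (QSh k Ω) (QSh k Ω) (QSh k Ω)).toAlgHom.comp
            ((Algebra.TensorProduct.map Γ Γ).comp (Bialgebra.comulAlgHom k (QSh k Ω)))) ∧
      -- `(ε ⊗ Id) Γ = u ε`, with `k ⊗ H^Ω` identified with `H^Ω`
      (Algebra.TensorProduct.lid k (QSh k Ω)).toAlgHom.comp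
          ((Algebra.TensorProduct.map (Bialgebra.counitAlgHom k (QSh k Ω))
            (AlgHom.id k (QSh k Ω))).comp Γ) =
        (Algebra.ofId k (QSh k Ω)).comp (Bialgebra.counitAlgHom k (QSh k Ω)) ∧
      -- `(S ⊗ Id) Γ = Γ S`
      (Algebra.TensorProduct.map (HopfAlgebra.antipodeAlgHom k (QSh k Ω))
          (AlgHom.id k (QSh k Ω))).comp Γ =
        Γ.comp (HopfAlgebra.antipodeAlgHom k (QSh k Ω)) := by

  refine ⟨fun _ => QSh.comm_comp_gamma_ne, QSh.gammaAlgHom k Ω, rfl, ?_,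
    ⟨QSh.gammaCounitAlgHom k Ω, ?_, ?_⟩, ?_, ?_, QSh.map_antipode_comp_gamma⟩
  · exact AlgHom.ext fun x => QSh.assoc_rTensor_gamma_gamma x
  · exact AlgHom.ext fun x => QSh.rTensor_gammaCounit_gamma x
  · exact AlgHom.ext fun x => QSh.lTensor_gammaCounit_gamma x
  · exact AlgHom.ext fun x => QSh.rTensor_deconc_gamma x
  · refine AlgHom.ext fun x => ?_
    change TensorProduct.lid k (QSh k Ω)
      ((QSh.deconcCounit k Ω).rTensor (QSh k Ω) (QSh.gamma k Ω x)) =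
        algebraMap k (QSh k Ω) (QSh.deconcCounit k Ω x)
    rw [QSh.rTensor_counit_gamma, TensorProduct.lid_tmul, Algebra.algebraMap_eq_smul_one]
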